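/- For $n\ge 1$ let $\mathcal S_n$ be the class of ball-bodies in $\mathbb R^n$, i.e. of all sets of the form $\bigcap_{x\in A}B(x,1)$ with $A\subseteq\mathbb R^n$, where $B(x,1)$ is the closed Euclidean ball of radius $1$ about $x$ (for $A=\emptyset$ the intersection is $\mathbb R^n$, and $\emptyset\in\mathcal S_n$ too). For a unit vector $u\in S^{n-1}$ and $K\in\mathcal S_n$, the Steiner symmetral of $K$ in direction $u$ is $$S_u(K)=\{x+yu : x\in u^\perp,\ K\cap(x+\mathbb Ru)\ne\emptyset,\ |y|\le \ell_x/2\},$$ where $\ell_x\in[0,\infty]$ is the length of $K\cap(x+\mathbb Ru)$. A lens is a nonempty intersection of two closed balls of radius $1$. **Theorem.** (1) If $K\in\mathcal S_2$ and $u\in S^1$, then $S_u(K)\in\mathcal S_2$. (2) This fails in dimension $3$: for every $u\in S^2$ there is a lens $L\in\mathcal S_3$ such that $S_u(L)\notin\mathcal S_3$. -/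

import Mathlib

/-- The class of ball-bodies in `ℝⁿ`: all intersections of families of closed Euclidean balls of
radius `1`. The empty family gives the whole space, and the empty set is a member as well. -/
def ballBodies (n : ℕ) : Set (Set (EuclideanSpace ℝ (Fin n))) :=
  {K | ∃ A : Set (EuclideanSpace ℝ (Fin n)), K = ⋂ x ∈ A, Metric.closedBall x 1}

/-- A lens: a nonempty intersection of two closed balls of radius `1`. -/
def IsLens {n : ℕ} (L : Set (EuclideanSpace ℝ (Fin n))) : Prop :=
  L.Nonempty ∧ ∃ c₁ c₂ : EuclideanSpace ℝ (Fin n),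
    L = Metric.closedBall c₁ 1 ∩ Metric.closedBall c₂ 1

/-- The fiber of `K` over `x` in direction `u`, as a set of real parameters. -/
def fiber {n : ℕ} (u : EuclideanSpace ℝ (Fin n)) (K : Set (EuclideanSpace ℝ (Fin n)))
    (x : EuclideanSpace ℝ (Fin n)) : Set ℝ :=
  {t : ℝ | x + t • u ∈ K}

/-- The Steiner symmetral of `K` in direction `u`: every nonempty fiber of `K` over a point `x` of
the hyperplane orthogonal to `u` is replaced by the closed segment of the same length centered
at `x` (by the whole line if the fiber has infinite length). -/
noncomputable def steinerSymmetral {n : ℕ} (u : EuclideanSpace ℝ (Fin n))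
    (K : Set (EuclideanSpace ℝ (Fin n))) : Set (EuclideanSpace ℝ (Fin n)) :=
  {p | ∃ (x : EuclideanSpace ℝ (Fin n)) (y : ℝ), inner ℝ x u = 0 ∧ p = x + y • u ∧
    (fiber u K x).Nonempty ∧
    ENNReal.ofReal |y| ≤ MeasureTheory.volume (fiber u K x) / 2}

/-! In the plane, the upper boundary of a symmetral is half the difference of an infimum of upper
unit arcs and a supremum of lower ones, so each bound comes from a pair of discs and is the average
of two upper unit arcs, up to a constant. The crux is that such an average lies below a single unit
arc touching it at a given abscissa. This follows from `concaveOn_arcHeight`: among unit arcs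
through a fixed point, the height at a fixed displacement is concave in the slope, so the arc with
the mean slope dominates. Every point off the symmetral is then cut off by one unit disc
(`isDiscSeparated_of_notMem`), and a set with this property is a ball-body.

In space, an explicit lens is used. A ball-body containing two points contains a small ball about
their midpoint (`mem_closedBall_of_near_midpoint`); two points of the symmetral and a point near
their midpoint but outside the symmetral contradict this. -/

/-- Every unit vector is the member of prescribed index of some orthonormal basis. -/
theorem exists_orthonormalBasis_apply_eq {n : ℕ} (i : Fin n) (u : EuclideanSpace ℝ (Fin n))
    (hu : ‖u‖ = 1) : ∃ b : OrthonormalBasis (Fin n) ℝ (EuclideanSpace ℝ (Fin n)), b i = u := by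
  have hv : Orthonormal ℝ (Set.domRestrict ({i} : Set (Fin n)) fun _ => u) :=
    ⟨fun _ => hu, fun j k hjk => absurd (Subsingleton.elim j k) hjk⟩
  obtain ⟨b, hb⟩ := hv.exists_orthonormalBasis_extension_of_card_eq (by simp)
  exact ⟨b, hb i rfl⟩

/-! ### Symmetrals through fiber lengths. -/

theorem mem_steinerSymmetral_iff {n : ℕ} {u : EuclideanSpace ℝ (Fin n)} (hu : ‖u‖ = 1)
    {K : Set (EuclideanSpace ℝ (Fin n))} {x : EuclideanSpace ℝ (Fin n)} (hx : inner ℝ x u = 0)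
    (y : ℝ) : x + y • u ∈ steinerSymmetral u K ↔ (fiber u K x).Nonempty ∧
      ENNReal.ofReal |y| ≤ MeasureTheory.volume (fiber u K x) / 2 := by
  constructor
  · rintro ⟨x', y', hx', h, hne, hle⟩
    have hy : y = y' := by
      have := congrArg (fun z => inner ℝ z u) h
      simpa [inner_add_left, inner_smul_left, hx, hx', hu] using this
    subst hy
    obtain rfl : x = x' := add_right_cancel h
    exact ⟨hne, hle⟩
  · rintro ⟨hne, hle⟩
    exact ⟨x, y, hx, rfl, hne, hle⟩

theorem ofReal_abs_le_half_volume_of_Icc_subset {s : Set ℝ} {a b y : ℝ} (h : Set.Icc a b ⊆ s)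
    (hy : 2 * |y| ≤ b - a) : ENNReal.ofReal |y| ≤ MeasureTheory.volume s / 2 := by
  rw [ENNReal.le_div_iff_mul_le (by simp) (by simp)]
  calc ENNReal.ofReal |y| * 2 = ENNReal.ofReal (|y| * 2) := by
        rw [ENNReal.ofReal_mul (abs_nonneg y)]; simp
    _ ≤ ENNReal.ofReal (b - a) := ENNReal.ofReal_le_ofReal (by linarith)
    _ = MeasureTheory.volume (Set.Icc a b) := by rw [Real.volume_Icc]
    _ ≤ _ := MeasureTheory.measure_mono h

theorem two_mul_abs_le_of_ofReal_le_half_volume {s : Set ℝ} {a b y : ℝ} (h : s ⊆ Set.Icc a b)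
    (hab : a ≤ b) (hy : ENNReal.ofReal |y| ≤ MeasureTheory.volume s / 2) : 2 * |y| ≤ b - a := by
  rw [ENNReal.le_div_iff_mul_le (by simp) (by simp)] at hy
  have h1 : ENNReal.ofReal (|y| * 2) ≤ ENNReal.ofReal (b - a) := by
    calc ENNReal.ofReal (|y| * 2) = ENNReal.ofReal |y| * 2 := by
          rw [ENNReal.ofReal_mul (abs_nonneg y)]; simp
      _ ≤ MeasureTheory.volume s := hy
      _ ≤ MeasureTheory.volume (Set.Icc a b) := MeasureTheory.measure_mono h
      _ = _ := by rw [Real.volume_Icc]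
  rw [ENNReal.ofReal_le_ofReal_iff (by linarith)] at h1
  linarith

/-! ### The counterexample in dimension 3. -/

/-- A point close to the midpoint of `p` and `q` lies in each unit ball containing `p` and `q`. -/
theorem mem_closedBall_of_near_midpoint {E : Type*} [NormedAddCommGroup E] [InnerProductSpace ℝ E]
    {p q z c : E} {r : ℝ} (hr : r ≤ 1) (hz : ‖z - midpoint ℝ p q‖ ≤ r)
    (hpq : 1 - (‖p - q‖ / 2) ^ 2 ≤ (1 - r) ^ 2) (hp : p ∈ Metric.closedBall c 1)
    (hq : q ∈ Metric.closedBall c 1) : z ∈ Metric.closedBall c 1 := by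
  rw [mem_closedBall_iff_norm] at *
  have h := parallelogram_law_with_norm ℝ (p - c) (q - c)
  have h1 : p - c + (q - c) = (2 : ℝ) • (midpoint ℝ p q - c) := by
    rw [midpoint_eq_smul_add, smul_sub, smul_smul]
    norm_num
    rw [two_smul]; abel
  have h2 : p - c - (q - c) = p - q := by abel
  rw [h1, h2, norm_smul] at h
  norm_num at h
  have h3 : ‖midpoint ℝ p q - c‖ ≤ 1 - r := by
    refine le_of_sq_le_sq ?_ (by linarith)
    nlinarith [norm_nonneg (p - c), norm_nonneg (q - c)]
  calc ‖z - c‖ = ‖(z - midpoint ℝ p q) + (midpoint ℝ p q - c)‖ := by congr 1; abel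
    _ ≤ _ := norm_add_le _ _
    _ ≤ 1 := by linarith

/-- The point with coordinates `x, y, z` in the given orthonormal basis. -/
noncomputable def coordPoint (b : OrthonormalBasis (Fin 3) ℝ (EuclideanSpace ℝ (Fin 3)))
    (x y z : ℝ) : EuclideanSpace ℝ (Fin 3) := b.repr.symm !₂[x, y, z]

section coordPoint
variable (b : OrthonormalBasis (Fin 3) ℝ (EuclideanSpace ℝ (Fin 3)))

theorem coordPoint_sub (x y z x' y' z' : ℝ) :
    coordPoint b x y z - coordPoint b x' y' z' = coordPoint b (x - x') (y - y') (z - z') := by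
  rw [coordPoint, coordPoint, coordPoint, ← map_sub]
  congr 1
  ext i; fin_cases i <;> simp

theorem coordPoint_midpoint (x y z x' y' z' : ℝ) :
    midpoint ℝ (coordPoint b x y z) (coordPoint b x' y' z') =
      coordPoint b ((x + x') / 2) ((y + y') / 2) ((z + z') / 2) := by
  rw [midpoint_eq_smul_add, coordPoint, coordPoint, coordPoint, ← map_add, ← map_smul]
  congr 1
  ext i; fin_cases i <;> simp <;> ring

theorem coordPoint_add_smul (x y z t : ℝ) :
    coordPoint b x y z + t • b 2 = coordPoint b x y (z + t) := by
  rw [coordPoint, coordPoint, ← OrthonormalBasis.repr_symm_single, ← map_smul, ← map_add]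
  congr 1
  ext i; fin_cases i <;> simp

theorem norm_sq_coordPoint (x y z : ℝ) : ‖coordPoint b x y z‖ ^ 2 = x ^ 2 + y ^ 2 + z ^ 2 := by
  rw [coordPoint, LinearIsometryEquiv.norm_map, EuclideanSpace.norm_sq_eq]
  simp [Fin.sum_univ_three]

theorem inner_coordPoint (x y z : ℝ) : inner ℝ (coordPoint b x y z) (b 2) = z := by
  rw [coordPoint, ← OrthonormalBasis.repr_symm_single, LinearIsometryEquiv.inner_map_map,
    EuclideanSpace.inner_single_right]
  simp

theorem coordPoint_mem_closedBall (x y z x' y' z' : ℝ) :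
    coordPoint b x y z ∈ Metric.closedBall (coordPoint b x' y' z') 1 ↔
      (x - x') ^ 2 + (y - y') ^ 2 + (z - z') ^ 2 ≤ 1 := by
  rw [mem_closedBall_iff_norm, coordPoint_sub, ← norm_sq_coordPoint b,
    sq_le_one_iff₀ (norm_nonneg _)]

theorem coordPoint_mem_steinerSymmetral (K : Set (EuclideanSpace ℝ (Fin 3))) (x y z : ℝ) :
    coordPoint b x y z ∈ steinerSymmetral (b 2) K ↔ (fiber (b 2) K (coordPoint b x y 0)).Nonempty ∧
      ENNReal.ofReal |z| ≤ MeasureTheory.volume (fiber (b 2) K (coordPoint b x y 0)) / 2 := by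
  rw [← mem_steinerSymmetral_iff (b.norm_eq_one 2) (inner_coordPoint b x y 0), coordPoint_add_smul,
    zero_add]

end coordPoint

theorem inter_mem_ballBodies {n : ℕ} (c₁ c₂ : EuclideanSpace ℝ (Fin n)) :
    Metric.closedBall c₁ 1 ∩ Metric.closedBall c₂ 1 ∈ ballBodies n :=
  ⟨{c₁, c₂}, by simp⟩

theorem exists_lens_steinerSymmetral_notMem_ballBodies (u : EuclideanSpace ℝ (Fin 3))
    (hu : ‖u‖ = 1) :
    ∃ L ∈ ballBodies 3, IsLens L ∧ steinerSymmetral u L ∉ ballBodies 3 := by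
  obtain ⟨b, rfl⟩ := exists_orthonormalBasis_apply_eq 2 u hu
  set L := Metric.closedBall (coordPoint b 0.45 0.75 (-0.381)) 1 ∩
    Metric.closedBall (coordPoint b 0.9 0.4 0) 1 with hL
  have hfib : ∀ x y t : ℝ, t ∈ fiber (b 2) L (coordPoint b x y 0) ↔
      (x - 0.45) ^ 2 + (y - 0.75) ^ 2 + (t + 0.381) ^ 2 ≤ 1 ∧
      (x - 0.9) ^ 2 + (y - 0.4) ^ 2 + t ^ 2 ≤ 1 := by
    intro x y t
    change coordPoint b x y 0 + t • b 2 ∈ L ↔ _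
    rw [coordPoint_add_smul, zero_add, hL, Set.mem_inter_iff, coordPoint_mem_closedBall,
      coordPoint_mem_closedBall, sub_neg_eq_add, sub_zero]
  have hIcc₁ : Set.Icc (-0.0545 : ℝ) (-0.038) ⊆ fiber (b 2) L (coordPoint b 0.03 (-0.09) 0) := by
    rintro t ⟨h1, h2⟩
    rw [hfib]
    constructor <;> nlinarith
  have hIcc₂ : Set.Icc (-0.1974 : ℝ) 0.1968 ⊆ fiber (b 2) L (coordPoint b (-0.03) 0.09 0) := by
    rintro t ⟨h1, h2⟩
    rw [hfib]
    constructor <;> nlinarith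
  -- The first ball bounds the fiber above, the second below. The length is at most 0.2039, short of
  -- the 2 · 0.1041 that `hp` would need.
  have hsub : fiber (b 2) L (coordPoint b (-0.0075) (-0.0043) 0) ⊆ Set.Icc (-0.114) 0.0899 := by
    intro t ht
    rw [hfib] at ht
    constructor <;> nlinarith [ht.1, ht.2]
  have hq₁ : coordPoint b 0.03 (-0.09) 0.008 ∈ steinerSymmetral (b 2) L := by
    rw [coordPoint_mem_steinerSymmetral]
    refine ⟨⟨-0.05, hIcc₁ (by norm_num)⟩, ofReal_abs_le_half_volume_of_Icc_subset hIcc₁ ?_⟩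
    rw [abs_of_pos (by norm_num)]; norm_num
  have hq₂ : coordPoint b (-0.03) 0.09 0.197 ∈ steinerSymmetral (b 2) L := by
    rw [coordPoint_mem_steinerSymmetral]
    refine ⟨⟨0, hIcc₂ (by norm_num)⟩, ofReal_abs_le_half_volume_of_Icc_subset hIcc₂ ?_⟩
    rw [abs_of_pos (by norm_num)]; norm_num
  have hp : coordPoint b (-0.0075) (-0.0043) 0.1041 ∉ steinerSymmetral (b 2) L := by
    rw [coordPoint_mem_steinerSymmetral]
    rintro ⟨-, h⟩
    have := two_mul_abs_le_of_ofReal_le_half_volume hsub (by norm_num) h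
    rw [abs_of_pos (by norm_num)] at this
    norm_num at this
  refine ⟨L, inter_mem_ballBodies _ _,
    ⟨⟨_, hIcc₂ (show (0 : ℝ) ∈ _ by norm_num)⟩, _, _, hL⟩, ?_⟩
  rintro ⟨A, hA⟩
  apply hp
  rw [hA] at hq₁ hq₂ ⊢
  rw [Set.mem_iInter₂] at *
  intro c hc
  -- The midpoint is `(0, 0, 0.1025)`; 0.0088 just exceeds the distance from it to the excluded
  -- point.
  refine mem_closedBall_of_near_midpoint (r := 0.0088) (by norm_num) ?_ ?_ (hq₁ c hc) (hq₂ c hc)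
  · rw [coordPoint_midpoint, coordPoint_sub]
    refine le_of_sq_le_sq ?_ (by norm_num)
    rw [norm_sq_coordPoint]
    norm_num
  · rw [coordPoint_sub, div_pow, norm_sq_coordPoint]
    norm_num

/-! ### Unit arcs and concavity in the slope. -/

/-- The convex function `(1 + p ^ 2) ^ (3 / 2)` lies above its tangent line at `p`. -/
theorem cubic_tangent_inequality {p w P W : ℝ} (hP : 0 < P) (hW : 0 < W) (hP2 : P ^ 2 = 1 + p ^ 2)
    (hW2 : W ^ 2 = 1 + w ^ 2) : P ^ 3 + 3 * p * P * (w - p) ≤ W ^ 3 := by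
  have hcs : 1 + p * w ≤ P * W := by
    refine abs_le_of_sq_le_sq' ?_ (by positivity) |>.2
    rw [mul_pow, hP2, hW2]
    nlinarith [sq_nonneg (p - w)]
  have h1 : 0 ≤ (W - P) ^ 2 * (W + 2 * P) := by positivity
  have h2 := mul_le_mul_of_nonneg_left hcs hP.le
  nlinarith

theorem hasDerivAt_inv_sqrt_one_add_sq (r : ℝ) :
    HasDerivAt (fun r : ℝ => (√(1 + r ^ 2))⁻¹) (-r * (√(1 + r ^ 2))⁻¹ ^ 3) r := by
  have hpos : 0 < 1 + r ^ 2 := by positivity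
  have hs := Real.sqrt_pos.2 hpos
  have h := (((hasDerivAt_id r).pow 2).const_add 1).sqrt hpos.ne' |>.inv hs.ne'
  refine h.congr_deriv ?_
  simp
  field_simp

theorem hasDerivAt_div_sqrt_one_add_sq (r : ℝ) :
    HasDerivAt (fun r : ℝ => r * (√(1 + r ^ 2))⁻¹) ((√(1 + r ^ 2))⁻¹ ^ 3) r := by
  have hpos : 0 < 1 + r ^ 2 := by positivity
  have hs := Real.sqrt_pos.2 hpos
  refine ((hasDerivAt_id r).mul (hasDerivAt_inv_sqrt_one_add_sq r)).congr_deriv ?_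
  simp
  have := Real.sq_sqrt hpos.le
  field_simp
  nlinarith

theorem strictMono_div_sqrt_one_add_sq : StrictMono fun r : ℝ => r * (√(1 + r ^ 2))⁻¹ :=
  strictMono_of_hasDerivAt_pos hasDerivAt_div_sqrt_one_add_sq fun r => by positivity

/-- The height at horizontal displacement `t` of the upper unit semicircle which passes through the
origin with slope `-r`. -/
noncomputable def arcHeight (t r : ℝ) : ℝ :=
  √(1 - (t + r * (√(1 + r ^ 2))⁻¹) ^ 2) - (√(1 + r ^ 2))⁻¹

theorem continuous_arcHeight (t : ℝ) : Continuous (arcHeight t) := by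
  unfold arcHeight
  have : ∀ r : ℝ, √(1 + r ^ 2) ≠ 0 := fun r => by positivity
  fun_prop (disch := assumption)

theorem concaveOn_arcHeight {t p q : ℝ} (hp : -1 ≤ t + p * (√(1 + p ^ 2))⁻¹)
    (hq : t + q * (√(1 + q ^ 2))⁻¹ ≤ 1) : ConcaveOn ℝ (Set.Icc p q) (arcHeight t) := by
  have hlt : ∀ r ∈ interior (Set.Icc p q), 0 < 1 - (t + r * (√(1 + r ^ 2))⁻¹) ^ 2 := by
    intro r hr
    rw [interior_Icc] at hr
    have h1 := strictMono_div_sqrt_one_add_sq hr.1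
    have h2 := strictMono_div_sqrt_one_add_sq hr.2
    simp only at h1 h2
    nlinarith
  -- `w r` is minus the slope of the arc at displacement `t`, as `r` is at displacement `0`.
  set w : ℝ → ℝ := fun r => (t + r * (√(1 + r ^ 2))⁻¹) / √(1 - (t + r * (√(1 + r ^ 2))⁻¹) ^ 2)
    with hw
  refine concaveOn_of_hasDerivWithinAt2_nonpos
    (f' := fun r => (√(1 + r ^ 2))⁻¹ ^ 3 * (r - w r))
    (f'' := fun r => (3 * (√(1 + r ^ 2))⁻¹ ^ 2 * (-r * (√(1 + r ^ 2))⁻¹ ^ 3)) * (r - w r) +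
      (√(1 + r ^ 2))⁻¹ ^ 3 * (1 - (√(1 + r ^ 2))⁻¹ ^ 3 *
        (√(1 - (t + r * (√(1 + r ^ 2))⁻¹) ^ 2))⁻¹ ^ 3))
    (convex_Icc p q) (continuous_arcHeight t).continuousOn ?_ ?_ ?_
  · intro r hr
    have h0 := hlt r hr
    have h1 := (((hasDerivAt_div_sqrt_one_add_sq r).const_add t).pow 2).const_sub 1 |>.sqrt h0.ne'
    refine ((h1.sub (hasDerivAt_inv_sqrt_one_add_sq r)).congr_deriv ?_).hasDerivWithinAt
    have hs := Real.sqrt_pos.2 h0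
    simp only [hw]
    simp
    field_simp
    ring
  · intro r hr
    have h0 := hlt r hr
    have hs := Real.sqrt_pos.2 h0
    have h1 := (((hasDerivAt_div_sqrt_one_add_sq r).const_add t).pow 2).const_sub 1 |>.sqrt h0.ne'
    have h2 := ((hasDerivAt_div_sqrt_one_add_sq r).const_add t).div h1 hs.ne'
    have h3 := ((hasDerivAt_inv_sqrt_one_add_sq r).pow 3).mul ((hasDerivAt_id r).sub h2)
    refine (h3.congr_deriv ?_).hasDerivWithinAt
    have hsq := Real.sq_sqrt h0.le
    simp only [hw]
    simp only [Pi.pow_apply, Pi.sub_apply, Pi.div_apply, id]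
    generalize t + r * (√(1 + r ^ 2))⁻¹ = a at hsq hs ⊢
    generalize √(1 - a ^ 2) = s at hsq hs ⊢
    norm_num
    left
    field_simp
    linear_combination hsq
  · intro r hr
    have h0 := hlt r hr
    have hs := Real.sqrt_pos.2 h0
    have hP : 0 < √(1 + r ^ 2) := by positivity
    have hP2 : √(1 + r ^ 2) ^ 2 = 1 + r ^ 2 := Real.sq_sqrt (by positivity)
    have hW2 : (√(1 - (t + r * (√(1 + r ^ 2))⁻¹) ^ 2))⁻¹ ^ 2 = 1 + w r ^ 2 := by
      have hsq := Real.sq_sqrt h0.le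
      simp only [hw]
      generalize t + r * (√(1 + r ^ 2))⁻¹ = a at *
      rw [div_pow, inv_pow, hsq]
      field_simp
      ring
    have key := cubic_tangent_inequality hP (inv_pos.2 hs) hP2 hW2
    set W := (√(1 - (t + r * (√(1 + r ^ 2))⁻¹) ^ 2))⁻¹
    set P := √(1 + r ^ 2)
    -- Up to a positive factor, the second derivative is the defect in the tangent inequality.
    have : 3 * P⁻¹ ^ 2 * (-r * P⁻¹ ^ 3) * (r - w r) + P⁻¹ ^ 3 * (1 - P⁻¹ ^ 3 * W ^ 3) =
        P⁻¹ ^ 6 * (P ^ 3 + 3 * r * P * (w r - r) - W ^ 3) := by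
      field_simp
      ring
    rw [this]
    exact mul_nonpos_of_nonneg_of_nonpos (by positivity) (by linarith)

theorem arcHeight_add_div_two_le {t p q : ℝ} (hp : |t + p * (√(1 + p ^ 2))⁻¹| ≤ 1)
    (hq : |t + q * (√(1 + q ^ 2))⁻¹| ≤ 1) :
    |t + (p + q) / 2 * (√(1 + ((p + q) / 2) ^ 2))⁻¹| ≤ 1 ∧
      (arcHeight t p + arcHeight t q) / 2 ≤ arcHeight t ((p + q) / 2) := by
  wlog hpq : p ≤ q generalizing p q
  · have := this hq hp (le_of_not_ge hpq)
    rwa [add_comm q p, add_comm (arcHeight t q)] at this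
  have h1 := strictMono_div_sqrt_one_add_sq.monotone (show p ≤ (p + q) / 2 by linarith)
  have h2 := strictMono_div_sqrt_one_add_sq.monotone (show (p + q) / 2 ≤ q by linarith)
  rw [abs_le] at *
  refine ⟨⟨by linarith, by linarith⟩, ?_⟩
  have h := (concaveOn_arcHeight hp.1 hq.2).2 (Set.left_mem_Icc.2 hpq) (Set.right_mem_Icc.2 hpq)
    (show (0 : ℝ) ≤ 1 / 2 by norm_num) (show (0 : ℝ) ≤ 1 / 2 by norm_num) (by norm_num)
  simp only [smul_eq_mul] at h
  rw [show 1 / 2 * p + 1 / 2 * q = (p + q) / 2 by ring] at h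
  linarith

theorem exists_slope {a : ℝ} (ha : |a| < 1) :
    ∃ p : ℝ, p * (√(1 + p ^ 2))⁻¹ = a ∧ (√(1 + p ^ 2))⁻¹ = √(1 - a ^ 2) := by
  have h0 : 0 < 1 - a ^ 2 := by have := (sq_lt_one_iff_abs_lt_one a).2 ha; linarith
  have hs := Real.sqrt_pos.2 h0
  have h1 : (√(1 + (a / √(1 - a ^ 2)) ^ 2))⁻¹ = √(1 - a ^ 2) := by
    rw [← Real.sqrt_inv, div_pow, Real.sq_sqrt h0.le]
    congr 1
    field_simp
    ring
  exact ⟨a / √(1 - a ^ 2), by rw [h1]; field_simp, h1⟩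

theorem sqrt_one_sub_sq_div_sqrt (r : ℝ) :
    √(1 - (r * (√(1 + r ^ 2))⁻¹) ^ 2) = (√(1 + r ^ 2))⁻¹ := by
  have hpos : 0 < 1 + r ^ 2 := by positivity
  rw [← Real.sqrt_inv, mul_pow, Real.sq_sqrt (by positivity)]
  congr 1
  field_simp
  ring

/-- The average of two unit arcs lies below a unit arc touching it at a prescribed abscissa. -/
theorem exists_arc_above_average {x₀ α β : ℝ} (hα : |x₀ - α| < 1) (hβ : |x₀ - β| < 1) :
    ∃ γ, min (√(1 - (x₀ - α) ^ 2)) (√(1 - (x₀ - β) ^ 2)) ≤ √(1 - (x₀ - γ) ^ 2) ∧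
      ∀ x, |x - α| ≤ 1 → |x - β| ≤ 1 → |x - γ| ≤ 1 ∧
        (√(1 - (x - α) ^ 2) + √(1 - (x - β) ^ 2)) / 2 -
          (√(1 - (x₀ - α) ^ 2) + √(1 - (x₀ - β) ^ 2)) / 2 ≤
        √(1 - (x - γ) ^ 2) - √(1 - (x₀ - γ) ^ 2) := by
  obtain ⟨p, hp, hp'⟩ := exists_slope hα
  obtain ⟨q, hq, hq'⟩ := exists_slope hβ
  set m := (p + q) / 2 with hm
  refine ⟨x₀ - m * (√(1 + m ^ 2))⁻¹, ?_, ?_⟩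
  -- The mean slope is no steeper than the steeper of `p` and `q`, and a flatter arc stands higher
  -- above its center.
  · rw [sub_sub_cancel, sqrt_one_sub_sq_div_sqrt, ← hp', ← hq', min_le_iff]
    have key : ∀ s : ℝ, m ^ 2 ≤ s ^ 2 → (√(1 + s ^ 2))⁻¹ ≤ (√(1 + m ^ 2))⁻¹ := fun s hs =>
      inv_anti₀ (by positivity) (Real.sqrt_le_sqrt (by linarith))
    rcases le_total (m ^ 2) (p ^ 2) with h | h
    · exact Or.inl (key p h)
    · refine Or.inr (key q ?_)
      rw [hm] at h ⊢
      nlinarith [sq_nonneg (p - q)]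
  · intro x hxα hxβ
    have e1 : x - x₀ + p * (√(1 + p ^ 2))⁻¹ = x - α := by rw [hp]; ring
    have e2 : x - x₀ + q * (√(1 + q ^ 2))⁻¹ = x - β := by rw [hq]; ring
    have e3 : x - (x₀ - m * (√(1 + m ^ 2))⁻¹) = x - x₀ + m * (√(1 + m ^ 2))⁻¹ := by ring
    obtain ⟨h1, h2⟩ := arcHeight_add_div_two_le (t := x - x₀) (p := p) (q := q)
      (by rwa [e1]) (by rwa [e2])
    rw [← hm] at h1 h2
    rw [sub_sub_cancel, sqrt_one_sub_sq_div_sqrt, e3]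
    refine ⟨h1, ?_⟩
    simp only [arcHeight] at h2
    rw [e1, e2, hp', hq'] at h2
    linarith

/-! ### Separation for a pair of discs. -/

theorem sq_add_sq_le_one_of_abs_le {x y : ℝ} (hx : |x| ≤ 1) (hy : |y| ≤ √(1 - x ^ 2)) :
    x ^ 2 + y ^ 2 ≤ 1 := by
  have h0 : 0 ≤ 1 - x ^ 2 := by have := (sq_le_one_iff_abs_le_one x).2 hx; linarith
  have := (Real.le_sqrt (abs_nonneg y) h0).1 hy
  rw [sq_abs] at this
  linarith

theorem one_lt_sq_add_sq_of_lt_abs {x y : ℝ} (hy : √(1 - x ^ 2) < |y|) : 1 < x ^ 2 + y ^ 2 := by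
  have := (Real.sqrt_lt' ((Real.sqrt_nonneg _).trans_lt hy)).1 hy
  rw [sq_abs] at this
  linarith

/-- The symmetrized intersection of two unit discs, with centers `(α, a)` and `(β, b)`, can be
separated by a unit disc from each point outside of it. -/
theorem exists_disc_of_average_lt {x₀ y₀ α β a b : ℝ} (hα : |x₀ - α| < 1) (hβ : |x₀ - β| < 1)
    (hy₀ : (a + √(1 - (x₀ - α) ^ 2) - (b - √(1 - (x₀ - β) ^ 2))) / 2 < |y₀|) :
    ∃ γ δ, 1 < (x₀ - γ) ^ 2 + (y₀ - δ) ^ 2 ∧ ∀ x y, |x - α| ≤ 1 → |x - β| ≤ 1 →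
      |y| ≤ √(1 - (x - α) ^ 2) → |y| ≤ √(1 - (x - β) ^ 2) →
      |y| ≤ (a + √(1 - (x - α) ^ 2) - (b - √(1 - (x - β) ^ 2))) / 2 →
      (x - γ) ^ 2 + (y - δ) ^ 2 ≤ 1 := by
  by_cases h1 : √(1 - (x₀ - β) ^ 2) < |y₀|
  · exact ⟨β, 0, one_lt_sq_add_sq_of_lt_abs (by simpa using h1), fun x y _ hx _ hy _ =>
      sq_add_sq_le_one_of_abs_le hx (by simpa using hy)⟩
  by_cases h2 : √(1 - (x₀ - α) ^ 2) < |y₀|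
  · exact ⟨α, 0, one_lt_sq_add_sq_of_lt_abs (by simpa using h2), fun x y hx _ hy _ _ =>
      sq_add_sq_le_one_of_abs_le hx (by simpa using hy)⟩
  push Not at h1 h2
  obtain ⟨γ, hγ, H⟩ := exists_arc_above_average hα hβ
  set h₀ := (a + √(1 - (x₀ - α) ^ 2) - (b - √(1 - (x₀ - β) ^ 2))) / 2 with hh₀
  set δ := h₀ - √(1 - (x₀ - γ) ^ 2) with hδ
  -- With its center on or below the axis, the disc under the dominating arc also contains the
  -- reflected lower half.
  have hδ0 : δ ≤ 0 := by
    rcases min_le_iff.1 hγ with h | h <;> linarith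
  have upper : ∀ x y, |x - α| ≤ 1 → |x - β| ≤ 1 →
      |y| ≤ (a + √(1 - (x - α) ^ 2) - (b - √(1 - (x - β) ^ 2))) / 2 →
      |y| - δ ≤ √(1 - (x - γ) ^ 2) := by
    intro x y hx hx' hy
    have := (H x hx hx').2
    rw [hδ, hh₀]
    linarith
  rcases le_total 0 y₀ with hy | hy
  · refine ⟨γ, δ, one_lt_sq_add_sq_of_lt_abs ?_, fun x y hx hx' _ _ hy' =>
      sq_add_sq_le_one_of_abs_le (H x hx hx').1 ?_⟩
    · rw [abs_of_nonneg hy] at hy₀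
      exact lt_of_lt_of_le (by linarith) (le_abs_self _)
    · have := upper x y hx hx' hy'
      rw [abs_le]
      constructor <;> linarith [neg_abs_le y, le_abs_self y]
  · refine ⟨γ, -δ, one_lt_sq_add_sq_of_lt_abs ?_, fun x y hx hx' _ _ hy' =>
      sq_add_sq_le_one_of_abs_le (H x hx hx').1 ?_⟩
    · rw [abs_of_nonpos hy] at hy₀
      exact lt_of_lt_of_le (by linarith) (neg_le_abs _)
    · have := upper x y hx hx' hy'
      rw [abs_le]
      constructor <;> linarith [neg_abs_le y, le_abs_self y]

/-! ### Separation for arbitrary families of discs. -/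

/-- The fiber over the abscissa `x` of the intersection of the unit discs with centers in `A`. -/
def discFiber (A : Set (ℝ × ℝ)) (x : ℝ) : Set ℝ :=
  {t | ∀ c ∈ A, (x - c.1) ^ 2 + (t - c.2) ^ 2 ≤ 1}

section discFiber
variable {A : Set (ℝ × ℝ)} {x y : ℝ} {c d : ℝ × ℝ}

theorem sq_add_sq_le_one_iff {s t : ℝ} (hs : |s| ≤ 1) :
    s ^ 2 + t ^ 2 ≤ 1 ↔ |t| ≤ √(1 - s ^ 2) :=
  ⟨fun h => not_lt.1 fun h' => absurd h (not_le.2 (one_lt_sq_add_sq_of_lt_abs h')),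
    sq_add_sq_le_one_of_abs_le hs⟩

theorem abs_sub_le_one_of_discFiber_nonempty (hc : c ∈ A) (h : (discFiber A x).Nonempty) :
    |x - c.1| ≤ 1 := by
  obtain ⟨t, ht⟩ := h
  rw [← sq_le_one_iff_abs_le_one]
  nlinarith [ht c hc]

theorem discFiber_subset_Icc (hc : c ∈ A) (hd : d ∈ A) (h : (discFiber A x).Nonempty) :
    discFiber A x ⊆ Set.Icc (d.2 - √(1 - (x - d.1) ^ 2)) (c.2 + √(1 - (x - c.1) ^ 2)) := by
  intro t ht
  have h1 := (sq_add_sq_le_one_iff (abs_sub_le_one_of_discFiber_nonempty hc h)).1 (ht c hc)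
  have h2 := (sq_add_sq_le_one_iff (abs_sub_le_one_of_discFiber_nonempty hd h)).1 (ht d hd)
  rw [abs_le] at h1 h2
  constructor <;> linarith

theorem abs_le_half_of_discFiber (hc : c ∈ A) (hd : d ∈ A) (h : (discFiber A x).Nonempty)
    (hy : ENNReal.ofReal |y| ≤ MeasureTheory.volume (discFiber A x) / 2) :
    |y| ≤ (c.2 + √(1 - (x - c.1) ^ 2) - (d.2 - √(1 - (x - d.1) ^ 2))) / 2 := by
  have hsub := discFiber_subset_Icc hc hd h
  have := two_mul_abs_le_of_ofReal_le_half_volume hsub (Set.nonempty_Icc.1 (h.mono hsub)) hy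
  linarith

theorem abs_le_sqrt_of_discFiber (hc : c ∈ A) (h : (discFiber A x).Nonempty)
    (hy : ENNReal.ofReal |y| ≤ MeasureTheory.volume (discFiber A x) / 2) :
    |y| ≤ √(1 - (x - c.1) ^ 2) := by
  linarith [abs_le_half_of_discFiber hc hc h hy]

theorem Icc_subset_discFiber {f g : ℝ} (hx : ∀ c ∈ A, |x - c.1| ≤ 1)
    (hf : ∀ c ∈ A, f ≤ c.2 + √(1 - (x - c.1) ^ 2)) (hg : ∀ c ∈ A, c.2 - √(1 - (x - c.1) ^ 2) ≤ g) :
    Set.Icc g f ⊆ discFiber A x := by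
  intro t ht c hc
  rw [sq_add_sq_le_one_iff (hx c hc), abs_le]
  constructor <;> linarith [hf c hc, hg c hc, ht.1, ht.2]

/-- There is a unit disc containing the symmetrized intersection of
the discs and avoiding the point `(x, y)`. -/
def IsDiscSeparated (A : Set (ℝ × ℝ)) (x y : ℝ) : Prop :=
  ∃ γ δ : ℝ, 1 < (x - γ) ^ 2 + (y - δ) ^ 2 ∧ ∀ x' y', (discFiber A x').Nonempty →
    ENNReal.ofReal |y'| ≤ MeasureTheory.volume (discFiber A x') / 2 →
    (x' - γ) ^ 2 + (y' - δ) ^ 2 ≤ 1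

theorem isDiscSeparated_of_average_lt (hc : c ∈ A) (hd : d ∈ A) (hxc : |x - c.1| < 1)
    (hxd : |x - d.1| < 1)
    (hy : (c.2 + √(1 - (x - c.1) ^ 2) - (d.2 - √(1 - (x - d.1) ^ 2))) / 2 < |y|) :
    IsDiscSeparated A x y := by
  obtain ⟨γ, δ, h1, h2⟩ := exists_disc_of_average_lt hxc hxd hy
  exact ⟨γ, δ, h1, fun x' y' hne hv => h2 x' y' (abs_sub_le_one_of_discFiber_nonempty hc hne)
    (abs_sub_le_one_of_discFiber_nonempty hd hne) (abs_le_sqrt_of_discFiber hc hne hv)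
    (abs_le_sqrt_of_discFiber hd hne hv) (abs_le_half_of_discFiber hc hd hne hv)⟩

theorem isDiscSeparated_of_one_lt (hc : c ∈ A) (h : 1 < (x - c.1) ^ 2 + y ^ 2) :
    IsDiscSeparated A x y :=
  ⟨c.1, 0, by simpa using h, fun _ _ hne hv =>
    sq_add_sq_le_one_of_abs_le (abs_sub_le_one_of_discFiber_nonempty hc hne)
      (by simpa using abs_le_sqrt_of_discFiber hc hne hv)⟩

/-- The fiber runs from the supremum of the lower arcs to the infimum of the upper ones, so too
short a fiber is witnessed by one pair, even if neither extremum is attained. -/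
theorem exists_average_lt_of_half_volume_lt (hne : (discFiber A x).Nonempty) (hA : A.Nonempty)
    (hv : MeasureTheory.volume (discFiber A x) / 2 < ENNReal.ofReal |y|) :
    ∃ c ∈ A, ∃ d ∈ A,
      (c.2 + √(1 - (x - c.1) ^ 2) - (d.2 - √(1 - (x - d.1) ^ 2))) / 2 < |y| := by
  by_contra! hcon
  refine absurd ?_ (not_le.2 hv)
  obtain ⟨t, ht⟩ := hne
  have hx := fun c hc => abs_sub_le_one_of_discFiber_nonempty (A := A) (c := c) hc ⟨t, ht⟩
  set T : Set ℝ := (fun c : ℝ × ℝ => c.2 + √(1 - (x - c.1) ^ 2)) '' A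
  set B : Set ℝ := (fun c : ℝ × ℝ => c.2 - √(1 - (x - c.1) ^ 2)) '' A
  have hT : ∀ c ∈ A, sInf T ≤ c.2 + √(1 - (x - c.1) ^ 2) := fun c hc => by
    refine csInf_le ⟨t, ?_⟩ ⟨c, hc, rfl⟩
    rintro _ ⟨d, hd, rfl⟩
    exact (discFiber_subset_Icc hd hd ⟨t, ht⟩ ht).2
  have hB : ∀ c ∈ A, c.2 - √(1 - (x - c.1) ^ 2) ≤ sSup B := fun c hc => by
    refine le_csSup ⟨t, ?_⟩ ⟨c, hc, rfl⟩
    rintro _ ⟨d, hd, rfl⟩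
    exact (discFiber_subset_Icc hd hd ⟨t, ht⟩ ht).1
  refine ofReal_abs_le_half_volume_of_Icc_subset (Icc_subset_discFiber hx hT hB) ?_
  have h1 : ∀ d ∈ A, 2 * |y| + (d.2 - √(1 - (x - d.1) ^ 2)) ≤ sInf T := fun d hd => by
    refine le_csInf (hA.image _) ?_
    rintro _ ⟨c, hc, rfl⟩
    linarith [hcon c hc d hd]
  have h2 : sSup B ≤ sInf T - 2 * |y| := by
    refine csSup_le (hA.image _) ?_
    rintro _ ⟨d, hd, rfl⟩
    linarith [h1 d hd]
  linarith

/-- Helly's theorem on the line: pairwise intersecting compact intervals share the supremum of their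
lower ends. -/
theorem exists_lt_of_discFiber_empty (hA : A.Nonempty) (hx : ∀ c ∈ A, |x - c.1| ≤ 1)
    (hne : ¬(discFiber A x).Nonempty) :
    ∃ c ∈ A, ∃ d ∈ A, c.2 + √(1 - (x - c.1) ^ 2) < d.2 - √(1 - (x - d.1) ^ 2) := by
  by_contra! hcon
  obtain ⟨e, he⟩ := hA
  set B : Set ℝ := (fun c : ℝ × ℝ => c.2 - √(1 - (x - c.1) ^ 2)) '' A
  refine hne ⟨sSup B, Icc_subset_discFiber hx (fun c hc => ?_) (fun c hc => ?_)
    (Set.left_mem_Icc.2 le_rfl)⟩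
  · refine csSup_le ⟨_, e, he, rfl⟩ ?_
    rintro _ ⟨d, hd, rfl⟩
    exact hcon c hc d hd
  · refine le_csSup ⟨e.2 + √(1 - (x - e.1) ^ 2), ?_⟩ ⟨c, hc, rfl⟩
    rintro _ ⟨d, hd, rfl⟩
    exact hcon e he d hd

theorem isDiscSeparated_of_lt (hc : c ∈ A) (hd : d ∈ A) (hxc : |x - c.1| ≤ 1) (hxd : |x - d.1| ≤ 1)
    {x' : ℝ} (hne : (discFiber A x').Nonempty) (hx' : ¬(discFiber A x).Nonempty)
    (h : c.2 + √(1 - (x - c.1) ^ 2) < d.2 - √(1 - (x - d.1) ^ 2)) : IsDiscSeparated A x y := by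
  have hxx' : x ≠ x' := by rintro rfl; exact hx' hne
  -- The pair lemma needs strict bounds on the abscissa. Moving `(x, y)` slightly towards the
  -- symmetral's point `(x', 0)` gives them; as the disc found contains `(x', 0)` but not the moved
  -- point, by convexity it misses `(x, y)`.
  set z : ℝ → ℝ := fun ε => (1 - ε) * x + ε * x' with hz
  have hcont : Filter.Tendsto (fun ε => d.2 - √(1 - (z ε - d.1) ^ 2) -
      (c.2 + √(1 - (z ε - c.1) ^ 2))) (nhdsWithin 0 (Set.Ioi 0))
      (nhds (d.2 - √(1 - (z 0 - d.1) ^ 2) - (c.2 + √(1 - (z 0 - c.1) ^ 2)))) := by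
    refine (Continuous.tendsto ?_ 0).mono_left nhdsWithin_le_nhds
    fun_prop
  have hz0 : z 0 = x := by simp [hz]
  rw [hz0] at hcont
  have hev := hcont.eventually (lt_mem_nhds (show 0 < _ by linarith))
  obtain ⟨ε, hε, hε0, hε1⟩ := (hev.and (Ioo_mem_nhdsGT (zero_lt_one' ℝ))).exists
  have hstrict : ∀ e : ℝ × ℝ, e ∈ A → |x - e.1| ≤ 1 → |z ε - e.1| < 1 := by
    intro e he hxe
    have hx'e := abs_sub_le_one_of_discFiber_nonempty he hne
    rw [← sq_lt_one_iff_abs_lt_one]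
    rw [← sq_le_one_iff_abs_le_one] at hxe hx'e
    have h1 : (z ε - e.1) ^ 2 = (1 - ε) * (x - e.1) ^ 2 + ε * (x' - e.1) ^ 2 -
        ε * (1 - ε) * (x - x') ^ 2 := by simp only [hz]; ring
    have h2 : 0 < ε * (1 - ε) * (x - x') ^ 2 :=
      mul_pos (mul_pos hε0 (by linarith)) (sq_pos_of_ne_zero (sub_ne_zero.2 hxx'))
    nlinarith
  obtain ⟨γ, δ, hout, hin⟩ := isDiscSeparated_of_average_lt (y := (1 - ε) * y) hc hd
    (hstrict c hc hxc) (hstrict d hd hxd) (lt_of_lt_of_le (by linarith) (abs_nonneg _))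
  refine ⟨γ, δ, ?_, hin⟩
  have h0 := hin x' 0 hne (by simp)
  have h1 : (z ε - γ) ^ 2 + ((1 - ε) * y - δ) ^ 2 = (1 - ε) * ((x - γ) ^ 2 + (y - δ) ^ 2) +
      ε * ((x' - γ) ^ 2 + (0 - δ) ^ 2) - ε * (1 - ε) * ((x - x') ^ 2 + y ^ 2) := by
    simp only [hz]; ring
  have h2 : 0 ≤ ε * (1 - ε) * ((x - x') ^ 2 + y ^ 2) :=
    mul_nonneg (mul_nonneg hε0.le (by linarith)) (by positivity)
  by_contra! h3
  nlinarith

theorem isDiscSeparated_of_notMem (hA : A.Nonempty) {x' : ℝ} (hne : (discFiber A x').Nonempty)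
    (h : ¬((discFiber A x).Nonempty ∧
      ENNReal.ofReal |y| ≤ MeasureTheory.volume (discFiber A x) / 2)) :
    IsDiscSeparated A x y := by
  by_cases hout : ∃ c ∈ A, 1 < (x - c.1) ^ 2 + y ^ 2
  · obtain ⟨c, hc, hlt⟩ := hout
    exact isDiscSeparated_of_one_lt hc hlt
  push Not at hout
  have hx : ∀ c ∈ A, |x - c.1| ≤ 1 := fun c hc => by
    rw [← sq_le_one_iff_abs_le_one]
    nlinarith [hout c hc]
  by_cases hxne : (discFiber A x).Nonempty
  · have hv : MeasureTheory.volume (discFiber A x) / 2 < ENNReal.ofReal |y| :=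
      not_le.1 fun h' => h ⟨hxne, h'⟩
    -- Nonzero height makes the bounds on the abscissa strict.
    have hy : 0 < |y| := ENNReal.ofReal_pos.1 (bot_le.trans_lt hv)
    have hx1 : ∀ c ∈ A, |x - c.1| < 1 := fun c hc => by
      rw [← sq_lt_one_iff_abs_lt_one]
      nlinarith [hout c hc, sq_abs y]
    obtain ⟨c, hc, d, hd, hlt⟩ := exists_average_lt_of_half_volume_lt hxne hA hv
    exact isDiscSeparated_of_average_lt hc hd (hx1 c hc) (hx1 d hd) hlt
  · obtain ⟨c, hc, d, hd, hlt⟩ := exists_lt_of_discFiber_empty hA hx hxne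
    exact isDiscSeparated_of_lt hc hd (hx c hc) (hx d hd) hne hxne hlt

end discFiber

/-! ### Transfer to the Euclidean plane. -/

/-- The point with coordinates `x, y` in the given orthonormal basis of the plane. -/
noncomputable def planePoint (b : OrthonormalBasis (Fin 2) ℝ (EuclideanSpace ℝ (Fin 2)))
    (x y : ℝ) : EuclideanSpace ℝ (Fin 2) := b.repr.symm !₂[x, y]

section planePoint
variable (b : OrthonormalBasis (Fin 2) ℝ (EuclideanSpace ℝ (Fin 2)))

theorem planePoint_repr (p : EuclideanSpace ℝ (Fin 2)) :
    planePoint b (b.repr p 0) (b.repr p 1) = p := by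
  rw [planePoint, LinearIsometryEquiv.symm_apply_eq]
  ext i; fin_cases i <;> simp

theorem planePoint_add_smul (x y t : ℝ) :
    planePoint b x y + t • b 1 = planePoint b x (y + t) := by
  rw [planePoint, planePoint, ← OrthonormalBasis.repr_symm_single, ← map_smul, ← map_add]
  congr 1
  ext i; fin_cases i <;> simp

theorem inner_planePoint (x y : ℝ) : inner ℝ (planePoint b x y) (b 1) = y := by
  rw [planePoint, ← OrthonormalBasis.repr_symm_single, LinearIsometryEquiv.inner_map_map,
    EuclideanSpace.inner_single_right]
  simp

theorem planePoint_mem_closedBall (x y x' y' : ℝ) :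
    planePoint b x y ∈ Metric.closedBall (planePoint b x' y') 1 ↔
      (x - x') ^ 2 + (y - y') ^ 2 ≤ 1 := by
  rw [mem_closedBall_iff_norm, planePoint, planePoint, ← map_sub, LinearIsometryEquiv.norm_map,
    ← sq_le_one_iff₀ (norm_nonneg _), EuclideanSpace.norm_sq_eq]
  simp [Fin.sum_univ_two]

theorem fiber_iInter_closedBall (A : Set (ℝ × ℝ)) (x : ℝ) :
    fiber (b 1) (⋂ c ∈ (fun c : ℝ × ℝ => planePoint b c.1 c.2) '' A, Metric.closedBall c 1)
      (planePoint b x 0) = discFiber A x := by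
  ext t
  change planePoint b x 0 + t • b 1 ∈ (⋂ c ∈ _, Metric.closedBall c 1) ↔ _
  rw [planePoint_add_smul, zero_add, Set.biInter_image, Set.mem_iInter₂]
  exact forall₂_congr fun c _ => planePoint_mem_closedBall b x t c.1 c.2

theorem planePoint_mem_steinerSymmetral (A : Set (ℝ × ℝ)) (x y : ℝ) :
    planePoint b x y ∈ steinerSymmetral (b 1)
      (⋂ c ∈ (fun c : ℝ × ℝ => planePoint b c.1 c.2) '' A, Metric.closedBall c 1) ↔
    (discFiber A x).Nonempty ∧
      ENNReal.ofReal |y| ≤ MeasureTheory.volume (discFiber A x) / 2 := by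
  rw [← fiber_iInter_closedBall b,
    ← mem_steinerSymmetral_iff (b.norm_eq_one 1) (inner_planePoint b x 0), planePoint_add_smul,
    zero_add]

end planePoint

theorem mem_ballBodies_of_forall_notMem {n : ℕ} {S : Set (EuclideanSpace ℝ (Fin n))}
    (h : ∀ p ∉ S, ∃ c, S ⊆ Metric.closedBall c 1 ∧ p ∉ Metric.closedBall c 1) :
    S ∈ ballBodies n := by
  refine ⟨{c | S ⊆ Metric.closedBall c 1}, Set.Subset.antisymm
    (Set.subset_iInter₂ fun c hc => hc) fun p hp => ?_⟩
  by_contra hpS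
  obtain ⟨c, hc, hpc⟩ := h p hpS
  exact hpc (Set.mem_iInter₂.1 hp c hc)

theorem steinerSymmetral_mem_ballBodies {K : Set (EuclideanSpace ℝ (Fin 2))} (hK : K ∈ ballBodies 2)
    {u : EuclideanSpace ℝ (Fin 2)} (hu : ‖u‖ = 1) : steinerSymmetral u K ∈ ballBodies 2 := by
  obtain ⟨b, rfl⟩ := exists_orthonormalBasis_apply_eq 1 u hu
  obtain ⟨C, rfl⟩ := hK
  obtain ⟨A, rfl⟩ : ∃ A : Set (ℝ × ℝ), (fun c : ℝ × ℝ => planePoint b c.1 c.2) '' A = C := by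
    refine ⟨(fun p => (b.repr p 0, b.repr p 1)) '' C, ?_⟩
    rw [Set.image_image]
    simp only [planePoint_repr, Set.image_id']
  set S := steinerSymmetral (b 1)
    (⋂ c ∈ (fun c : ℝ × ℝ => planePoint b c.1 c.2) '' A, Metric.closedBall c 1)
  have hmem : ∀ x y, planePoint b x y ∈ S ↔ (discFiber A x).Nonempty ∧
      ENNReal.ofReal |y| ≤ MeasureTheory.volume (discFiber A x) / 2 :=
    planePoint_mem_steinerSymmetral b A
  refine mem_ballBodies_of_forall_notMem fun p hp => ?_
  obtain ⟨x, y, rfl⟩ : ∃ x y, planePoint b x y = p := ⟨_, _, planePoint_repr b p⟩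
  rw [hmem] at hp
  have hA : A.Nonempty := by
    rw [Set.nonempty_iff_ne_empty]
    rintro rfl
    -- Without discs the fibers are whole lines of infinite length, so no point is missed.
    exact hp (by simp [discFiber, ENNReal.top_div_of_ne_top])
  have hsep : IsDiscSeparated A x y := by
    by_cases hne : ∃ x', (discFiber A x').Nonempty
    · exact isDiscSeparated_of_notMem hA hne.choose_spec hp
    -- The symmetral is empty, so any disc avoiding the point will do.
    · exact ⟨x - 2, y, by norm_num, fun x' _ h => absurd ⟨x', h⟩ hne⟩
  obtain ⟨γ, δ, hout, hin⟩ := hsep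
  refine ⟨planePoint b γ δ, fun q hq => ?_, ?_⟩
  · obtain ⟨x', y', rfl⟩ : ∃ x' y', planePoint b x' y' = q := ⟨_, _, planePoint_repr b q⟩
    rw [hmem] at hq
    rw [planePoint_mem_closedBall]
    exact hin x' y' hq.1 hq.2
  · rw [planePoint_mem_closedBall, not_le]
    exact hout

theorem mainTheorem8 :
    (∀ K ∈ ballBodies 2, ∀ u : EuclideanSpace ℝ (Fin 2), ‖u‖ = 1 →
      steinerSymmetral u K ∈ ballBodies 2) ∧
    (∀ u : EuclideanSpace ℝ (Fin 3), ‖u‖ = 1 →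
      ∃ L ∈ ballBodies 3, IsLens L ∧ steinerSymmetral u L ∉ ballBodies 3) :=
  ⟨fun _ hK _ hu => steinerSymmetral_mem_ballBodies hK hu,
    exists_lens_steinerSymmetral_notMem_ballBodies⟩
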